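/- For a group $\Gamma$ write $H_2(\Gamma)=H_2(\Gamma,\mathbb Z)$. For commuting $x,y\in\Gamma$ let $\langle x,y\rangle\in H_2(\Gamma)$ be the image of the fundamental class of $H_2(\mathbb Z^2)$ (the class of the cycle $[e_1|e_2]-[e_2|e_1]$) under the homomorphism $\mathbb Z^2\to\Gamma$, $(m,n)\mapsto x^my^n$. Write $Z(g)$ for the centralizer of $g$ and $\Gamma'$ for the derived group of $\Gamma$. For a list $D=(D_1,\dots,D_r)$ of conjugacy classes of $\Gamma$ put $$H_2(\Gamma)_{D_i}=\{\langle g,z\rangle: g\in D_i,\ z\in Z(g)\},\qquad H_2'(\Gamma)_{D_i}=\{\langle g,z\rangle: g\in D_i,\ z\in Z(g)\cap \Gamma'\},$$ which are subgroups of $H_2(\Gamma)$, and $$H_2(\Gamma)_D=\sum_i H_2(\Gamma)_{D_i},\qquad H_2'(\Gamma)_D=\sum_i H_2'(\Gamma)_{D_i},\qquad H_2(\Gamma,D)=H_2(\Gamma)/H_2(\Gamma)_D .$$ A finite group $G$ with trivial center is called pseudosimple if $G'\cong T^w$ for some nonabelian simple group $T$ and some $w\ge 1$, and $G/N$ is abelian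 for every nontrivial normal subgroup $N$ of $G$. It is of split-cyclic type if the canonical surjection $G\to G^{\mathrm{ab}}$ has a homomorphic section and $G^{\mathrm{ab}}$ is cyclic. A conjugacy class of $G$ is unambiguous if $G'$ acts transitively on it by conjugation. For $k\ge 1$ let $G^{[k]}=G\times_{G^{\mathrm{ab}}}\cdots\times_{G^{\mathrm{ab}}}G$ be the $k$-fold fiber power. If $C=(C_1,\dots,C_r)$ is a list of unambiguous classes of $G$, let $C^k=(C_1^k,\dots,C_r^k)$ be the list of Cartesian powers $C_i^k\subseteq G^{[k]}$; each $C_i^k$ is then a single conjugacy class of $G^{[k]}$. **Proposition.** Let $G$ be a pseudosimple group of split-cyclic type, and let $C=(C_1,\dots,C_r)$ be a list of distinct unambiguous conjugacy classes of $G$. Then the following are equivalent: - ($3$) $|H_2(G^{[2]},C^2)|=|H_2(G,C)|^2$; - ($\hat 3$) $|H_2(G^{[k]},C^k)|=|H_2(G,C)|^k$ for all positive integers $k$; - ($\mathrm E$) $H_2(G)_C=H_2'(G)_C$. Moreover, if $|G^{\mathrm{ab}}|$ is relatively prime to $|H_2(G)|$, then all three conditions hold. -/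

import Mathlib

namespace SchurMult

/-! Groups live in `Type`, which loses nothing for finite groups. -/

/-- The Schur multiplier `H₂(G) = H₂(G, ℤ)`: group homology with coefficients in the trivial
module `ℤ`. -/
noncomputable abbrev H2Z (G : Type) [Group G] : ModuleCat ℤ :=
  groupHomology.H2 (Rep.trivial ℤ G ℤ)

/-- The inhomogeneous `2`-chain `[x|y] - [y|x]`. -/
noncomputable def bracketChain {G : Type} (x y : G) : G × G →₀ ℤ :=
  Finsupp.single (x, y) 1 - Finsupp.single (y, x) 1

theorem bracketChain_mem_cycles {G : Type} [Group G] {x y : G} (h : Commute x y) :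
    bracketChain x y ∈ groupHomology.cycles₂ (Rep.trivial ℤ G ℤ) := by
  change groupHomology.d₂₁ (Rep.trivial ℤ G ℤ) (bracketChain x y) = 0
  have h' : x * y = y * x := h
  unfold bracketChain
  erw [map_sub, groupHomology.d₂₁_single, groupHomology.d₂₁_single]
  simp only [h', Representation.trivial_apply]
  abel

/-- For commuting `x`, `y`, the element `⟨x, y⟩ ∈ H₂(G)`: the image of the fundamental class
of `H₂(ℤ²)`, which is represented by the cycle `[e₁|e₂] - [e₂|e₁]`, under the homomorphism
`ℤ² → G`, `(m, n) ↦ x ^ m * y ^ n`. Equivalently (up to the usual sign convention), the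
commutator of lifts of `x` and `y` to a Schur cover. -/
noncomputable def bracket {G : Type} [Group G] {x y : G} (h : Commute x y) : H2Z G :=
  groupHomology.H2π (Rep.trivial ℤ G ℤ) ⟨bracketChain x y, bracketChain_mem_cycles h⟩

/-- The subgroup `H₂(G)_X` of `H₂(G)` generated by the `⟨g, z⟩` with `g ∈ X` and `z` in the
centralizer of `g`. When `X` is a conjugacy class these elements already form a subgroup. -/
noncomputable def H2Class {G : Type} [Group G] (X : Set G) : AddSubgroup (H2Z G) :=
  AddSubgroup.closure {ξ | ∃ (g z : G) (h : Commute g z), g ∈ X ∧ ξ = bracket h}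

/-- The subgroup `H₂'(G)_X` of `H₂(G)` generated by the `⟨g, z⟩` with `g ∈ X` and `z` in the
intersection of the centralizer of `g` with the derived group. When `X` is a conjugacy class
these elements already form a subgroup. -/
noncomputable def H2ClassDerived {G : Type} [Group G] (X : Set G) : AddSubgroup (H2Z G) :=
  AddSubgroup.closure
    {ξ | ∃ (g z : G) (h : Commute g z), g ∈ X ∧ z ∈ commutator G ∧ ξ = bracket h}

/-- `H₂(G)_C = ∑ᵢ H₂(G)_{Cᵢ}`. -/
noncomputable def H2List {G : Type} [Group G] {r : ℕ} (C : Fin r → Set G) :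
    AddSubgroup (H2Z G) :=
  ⨆ i, H2Class (C i)

/-- `H₂'(G)_C = ∑ᵢ H₂'(G)_{Cᵢ}`. -/
noncomputable def H2ListDerived {G : Type} [Group G] {r : ℕ} (C : Fin r → Set G) :
    AddSubgroup (H2Z G) :=
  ⨆ i, H2ClassDerived (C i)

/-- The reduced Schur multiplier `H₂(G, C) = H₂(G) / H₂(G)_C`. -/
abbrev ReducedH2 {G : Type} [Group G] {r : ℕ} (C : Fin r → Set G) : Type :=
  H2Z G ⧸ H2List C

/-- The `k`-fold fiber power `G^[k]` of `G` over its abelianization (for `k ≥ 1`). -/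
def fiberPower (G : Type) [Group G] (k : ℕ) : Subgroup (Fin k → G) where
  carrier := {x | ∀ a b, Abelianization.of (x a) = Abelianization.of (x b)}
  one_mem' := fun _ _ => rfl
  mul_mem' := by
    intro x y hx hy a b
    simp only [Pi.mul_apply, map_mul, hx a b, hy a b]
  inv_mem' := by
    intro x hx a b
    simp only [Pi.inv_apply, map_inv, hx a b]

/-- The sets underlying a list of conjugacy classes. -/
def classSets {G : Type} [Group G] {r : ℕ} (C : Fin r → ConjClasses G) : Fin r → Set G :=
  fun i => (C i).carrier

/-- The Cartesian powers `Cᵢ^k`, as subsets of `G^[k]`. All coordinates of a tuple in `Cᵢ^k`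
automatically agree in the abelianization; if `Cᵢ` is unambiguous then `Cᵢ^k` is a single
conjugacy class of `G^[k]`. -/
def classPowers {G : Type} [Group G] {r : ℕ} (C : Fin r → ConjClasses G) (k : ℕ) :
    Fin r → Set (fiberPower G k) :=
  fun i => {x | ∀ a, (x : Fin k → G) a ∈ (C i).carrier}

/-- A conjugacy class is unambiguous if the derived group acts transitively on it by
conjugation. -/
def IsUnambiguous {G : Type} [Group G] (c : ConjClasses G) : Prop :=
  ∀ x ∈ c.carrier, ∀ y ∈ c.carrier, ∃ g ∈ commutator G, g * x * g⁻¹ = y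

/-- A centerless finite group is pseudosimple if its derived group is a (positive) power of a
nonabelian simple group and every proper quotient is abelian. -/
structure IsPseudosimple (G : Type) [Group G] : Prop where
  finite : Finite G
  centerless : Subgroup.center G = ⊥
  derived_eq_power : ∃ (T : Type) (_ : Group T) (w : ℕ),
    IsSimpleGroup T ∧ (∃ a b : T, a * b ≠ b * a) ∧ 1 ≤ w ∧
      Nonempty (commutator G ≃* (Fin w → T))
  quotient_abelian : ∀ (N : Subgroup G) [N.Normal], N ≠ ⊥ → ∀ a b : G ⧸ N, a * b = b * a

/-- `G` is of split-cyclic type: `G → G^ab` has a homomorphic section and `G^ab` is cyclic. -/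
def IsSplitCyclic (G : Type) [Group G] : Prop :=
  (∃ s : Abelianization G →* G, ∀ a, Abelianization.of (s a) = a) ∧ IsCyclic (Abelianization G)

end SchurMult

/-!
For a pseudosimple group `G` of split-cyclic type, with `N = G'` perfect and `A = G^ab` cyclic, the
coordinate projections induce an isomorphism `H₂(G^[k]) ≃ H₂(G)^k` (`H2fiberProj_bijective`), and
everything else is bookkeeping with the classes `⟨g, z⟩` inside `H₂(G)^k`.

**The isomorphism.** Let `s : A → G` be a section. The map `ιⱼ : G → G^[k]` sending `g` to the tuple
with `g` in slot `j` and `s(ḡ)` elsewhere is a homomorphism (`fiberSlot`). Its composite with the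
`i`-th projection is the identity for `i = j`, and factors through `A` otherwise; since `A` is
cyclic, `H₂(A) = 0`, so the `ιⱼ` together give a right inverse of the projections on `H₂`. It remains
to see that the images of the `ιⱼ` generate `H₂(G^[k])` (`iSup_range_H2map_fiberSlot`). If not, some
character `H₂(G^[k]) → ℚ/ℤ` kills all these images without being zero. As `ℚ/ℤ` is divisible, the
character comes from a `2`-cocycle which becomes a coboundary after pulling back along every `ιⱼ`;
that is, every `ιⱼ` lifts to the corresponding central extension `E`. Two lifts to a central
extension of the same homomorphism from a perfect group coincide (`lift_unique_of_isPerfect`).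
Hence the lifts of the `k` copies of `N` commute with one another and are compatible with the action
of the lifted copy of `A`, and they glue to a section of `E → G^[k] = N^k ⋊ A`. So the cocycle is a
coboundary and the character is zero after all.

**The equivalence.** Write `H_C ⊇ H'_C` for `H₂(G)_C ⊇ H₂'(G)_C` and `I` for the image of
`H₂(G^[k])_{C^k}` in `H₂(G)^k`. Then `(H'_C)^k ≤ I ≤ (H_C)^k`, where the first inclusion puts an element
of `Z(g) ∩ G'` in one slot and `1` in the others. As `H₂(G)` is finite, the cardinality condition for
`k` says exactly `I = (H_C)^k`; this holds if `H_C = H'_C`. Conversely, two coordinates of an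
element of `I` differ by an element of `H'_C` (`H2map_fiberProj_sub_mem`): after conjugation, the
generators in the two coordinates are `⟨g, u⟩` and `⟨g, v⟩` with `u v⁻¹ ∈ G'`. If `I = (H_C)²`, apply
this to `(ξ, 0)` to find `ξ ∈ H'_C`. Finally `|A| ⟨g, z⟩ = ⟨g, z^|A|⟩ ∈ H'_C`, which gives `H_C = H'_C`
when `|A|` is prime to `|H₂(G)|`.
-/

namespace SchurMult

open groupHomology

/-! ### Second homology in terms of chains -/

variable {G K L : Type} [Group G] [Group K] [Group L]

theorem d₂₁_trivial_single (x y : G) (n : ℤ) :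
    d₂₁ (Rep.trivial ℤ G ℤ) (Finsupp.single (x, y) n) =
      Finsupp.single y n - Finsupp.single (x * y) n + Finsupp.single x n := by
  erw [d₂₁_single]
  rfl

theorem d₃₂_trivial_single (x y z : G) (n : ℤ) :
    d₃₂ (Rep.trivial ℤ G ℤ) (Finsupp.single (x, y, z) n) =
      Finsupp.single (y, z) n - Finsupp.single (x * y, z) n + Finsupp.single (x, y * z) n -
        Finsupp.single (x, y) n := by
  erw [d₃₂_single]
  rfl

theorem mem_boundaries₂_single (x y z : G) :
    (Finsupp.single (y, z) 1 - Finsupp.single (x * y, z) 1 + Finsupp.single (x, y * z) 1 -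
        Finsupp.single (x, y) 1 : G × G →₀ ℤ) ∈ boundaries₂ (Rep.trivial ℤ G ℤ) :=
  ⟨Finsupp.single (x, y, z) (1 : ℤ), d₃₂_trivial_single x y z 1⟩

variable (G) in
/-- The class in `H₂(G)` of a `2`-cycle. -/
noncomputable def H2mk : cycles₂ (Rep.trivial ℤ G ℤ) →ₗ[ℤ] H2Z G :=
  (H2π (Rep.trivial ℤ G ℤ)).hom

theorem H2mk_surjective : Function.Surjective (H2mk G) :=
  (ModuleCat.epi_iff_surjective _).1 inferInstance

theorem H2mk_eq_zero_iff (x : cycles₂ (Rep.trivial ℤ G ℤ)) :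
    H2mk G x = 0 ↔ x.1 ∈ boundaries₂ (Rep.trivial ℤ G ℤ) :=
  H2π_eq_zero_iff x

theorem bracket_eq_H2mk {x y : G} (h : Commute x y) :
    bracket h = H2mk G ⟨bracketChain x y, bracketChain_mem_cycles h⟩ := rfl

/-- The homomorphism `H₂(G) → H₂(K)` induced by a group homomorphism. -/
noncomputable def H2map (f : G →* K) : H2Z G →+ H2Z K :=
  (groupHomology.map (A := Rep.trivial ℤ G ℤ) (B := Rep.trivial ℤ K ℤ) f
    (CategoryTheory.CategoryStruct.id (Rep.trivial ℤ G ℤ)) 2).hom.toAddMonoidHom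

/-- The map on inhomogeneous `2`-chains induced by a group homomorphism. -/
noncomputable def chainMap (f : G →* K) : (G × G →₀ ℤ) →+ (K × K →₀ ℤ) :=
  Finsupp.mapDomain.addMonoidHom (Prod.map f f)

theorem coe_mapCycles₂_trivial (f : G →* K) (z : cycles₂ (Rep.trivial ℤ G ℤ)) :
    (mapCycles₂ (A := Rep.trivial ℤ G ℤ) (B := Rep.trivial ℤ K ℤ) f
      (CategoryTheory.CategoryStruct.id (Rep.trivial ℤ G ℤ)) z).1 = chainMap f z.1 := by
  change Finsupp.mapRange.linearMap (LinearMap.id : ℤ →ₗ[ℤ] ℤ)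
    (Finsupp.mapDomain (Prod.map f f) z.1) = Finsupp.mapDomain (Prod.map f f) z.1
  simp

theorem chainMap_mem_cycles (f : G →* K) {z : G × G →₀ ℤ}
    (hz : z ∈ cycles₂ (Rep.trivial ℤ G ℤ)) : chainMap f z ∈ cycles₂ (Rep.trivial ℤ K ℤ) :=
  coe_mapCycles₂_trivial f ⟨z, hz⟩ ▸ SetLike.coe_mem _

theorem H2map_H2mk (f : G →* K) (z : cycles₂ (Rep.trivial ℤ G ℤ)) :
    H2map f (H2mk G z) = H2mk K ⟨chainMap f z.1, chainMap_mem_cycles f z.2⟩ := by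
  have := H2π_comp_map_apply (A := Rep.trivial ℤ G ℤ) (B := Rep.trivial ℤ K ℤ) f
    (CategoryTheory.CategoryStruct.id (Rep.trivial ℤ G ℤ)) z
  refine this.trans (congrArg (H2mk K) ?_)
  exact Subtype.ext (coe_mapCycles₂_trivial f z)

theorem H2map_bracket (f : G →* K) {x y : G} (h : Commute x y) :
    H2map f (bracket h) = bracket (h.map f) := by
  rw [bracket_eq_H2mk, H2map_H2mk, bracket_eq_H2mk]
  congr 2
  change chainMap f (_ - _) = _
  rw [map_sub]
  simp [chainMap, bracketChain]

theorem H2map_id (x : H2Z G) : H2map (MonoidHom.id G) x = x := by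
  obtain ⟨z, rfl⟩ := H2mk_surjective x
  rw [H2map_H2mk]
  congr 1
  ext : 1
  simp [chainMap]

theorem H2map_comp (g : K →* L) (f : G →* K) (x : H2Z G) :
    H2map (g.comp f) x = H2map g (H2map f x) := by
  obtain ⟨z, rfl⟩ := H2mk_surjective x
  rw [H2map_H2mk, H2map_H2mk, H2map_H2mk]
  congr 2
  simp only [chainMap, Finsupp.mapDomain.addMonoidHom_apply, ← Finsupp.mapDomain_comp]
  rfl

theorem bracket_eq_of_sub_mem {x y u v : G} (h : Commute x y) (h' : Commute u v)
    (hb : bracketChain x y - bracketChain u v ∈ boundaries₂ (Rep.trivial ℤ G ℤ)) :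
    bracket h = bracket h' := by
  rw [← sub_eq_zero, bracket_eq_H2mk, bracket_eq_H2mk, ← map_sub, H2mk_eq_zero_iff]
  exact hb

/-- `⟨g, zw⟩ = ⟨g, z⟩ + ⟨g, w⟩`: the difference of the cycles is the boundary of
`[g|z|w] + [z|w|g] - [z|g|w]`. -/
theorem bracket_mul_right {g z w : G} (hz : Commute g z) (hw : Commute g w) :
    bracket (hz.mul_right hw) = bracket hz + bracket hw := by
  rw [← sub_eq_zero, bracket_eq_H2mk, bracket_eq_H2mk, bracket_eq_H2mk, ← map_add, ← map_sub,
    H2mk_eq_zero_iff]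
  have := sub_mem (add_mem (mem_boundaries₂_single g z w) (mem_boundaries₂_single z w g))
    (mem_boundaries₂_single z g w)
  convert! this using 1
  simp only [bracketChain, Submodule.coe_sub, Submodule.coe_add, hz.eq, hw.eq]
  abel

/-- Brackets are invariant under conjugation, as inner automorphisms act trivially on homology. With
`x' = gxg⁻¹`, the standard chain homotopy is `[x|y] ↦ [x'|y'|g] - [x'|g|y] + [g|x|y]`; for commuting
`x` and `y` the boundary terms symmetric in `x` and `y` cancel. -/
theorem bracket_conj {x y : G} (h : Commute x y) (g : G)
    (h' : Commute (g * x * g⁻¹) (g * y * g⁻¹)) : bracket h' = bracket h := by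
  symm
  apply bracket_eq_of_sub_mem
  have key : ∀ x y : G,
      (Finsupp.single (g * y * g⁻¹, g) 1 - Finsupp.single (g * (x * y) * g⁻¹, g) 1
        - Finsupp.single (g * x * g⁻¹, g * y * g⁻¹) 1 - Finsupp.single (g, y) 1
        + Finsupp.single (g * x * g⁻¹, g) 1 + Finsupp.single (x, y) 1 + Finsupp.single (g, x * y) 1
        - Finsupp.single (g, x) 1 : G × G →₀ ℤ) ∈ boundaries₂ (Rep.trivial ℤ G ℤ) := by
    intro x y
    have := add_mem (sub_mem (mem_boundaries₂_single (g * x * g⁻¹) (g * y * g⁻¹) g)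
      (mem_boundaries₂_single (g * x * g⁻¹) g y)) (mem_boundaries₂_single g x y)
    convert! this using 1
    have e1 : g * x * g⁻¹ * (g * y * g⁻¹) = g * (x * y) * g⁻¹ := by group
    have e2 : g * y * g⁻¹ * g = g * y := by group
    have e3 : g * x * g⁻¹ * g = g * x := by group
    rw [e1, e2, e3]
    abel
  convert! sub_mem (key x y) (key y x) using 1
  simp only [bracketChain, h.eq]
  abel

/-! ### Finiteness -/

/-- Multiplication by `|G|` is null-homotopic on positive-degree chains, via
`[x|y] ↦ ∑ g, [g|x|y]`. -/
theorem card_nsmul_H2_eq_zero [Finite G] (x : H2Z G) : Nat.card G • x = 0 := by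
  have := Fintype.ofFinite G
  obtain ⟨z, rfl⟩ := H2mk_surjective x
  rw [← map_nsmul, H2mk_eq_zero_iff, Nat.card_eq_fintype_card]
  let d : (G × G →₀ ℤ) →+ (G →₀ ℤ) := (d₂₁ (Rep.trivial ℤ G ℤ)).hom.toAddMonoidHom
  let D : (G × G × G →₀ ℤ) →+ (G × G →₀ ℤ) := (d₃₂ (Rep.trivial ℤ G ℤ)).hom.toAddMonoidHom
  let s : (G × G →₀ ℤ) →+ (G × G × G →₀ ℤ) :=
    ∑ g : G, Finsupp.mapDomain.addMonoidHom (fun p => (g, p))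
  let t : (G →₀ ℤ) →+ (G × G →₀ ℤ) := ∑ g : G, Finsupp.mapDomain.addMonoidHom (fun p => (g, p))
  -- The homotopy identity `∂s = |G| - t∂`.
  have key : D.comp s = Fintype.card G • AddMonoidHom.id _ - t.comp d := by
    refine Finsupp.addHom_ext fun ⟨x, y⟩ n => ?_
    have h1 : d (Finsupp.single (x, y) n) =
        Finsupp.single y n - Finsupp.single (x * y) n + Finsupp.single x n :=
      d₂₁_trivial_single x y n
    have h2 : ∀ g, D (Finsupp.single (g, x, y) n) = _ := fun g => d₃₂_trivial_single g x y n
    have h3 : ∀ w, t w = ∑ g : G, Finsupp.mapDomain (fun p => (g, p)) w := fun w => by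
      simp [t, AddMonoidHom.finsetSum_apply]
    have h4 : ∀ w, s w = ∑ g : G, Finsupp.mapDomain (fun p => (g, p)) w := fun w => by
      simp [s, AddMonoidHom.finsetSum_apply]
    have h5 : ∑ g : G, Finsupp.single (g * x, y) n = ∑ g : G, Finsupp.single (g, y) n :=
      Fintype.sum_equiv (Equiv.mulRight x) _ _ fun _ => rfl
    simp only [AddMonoidHom.comp_apply, h4, Finsupp.mapDomain_single, map_sum, h2,
      AddMonoidHom.sub_apply, AddMonoidHom.smul_apply, AddMonoidHom.id_apply, h1, map_add, map_sub]
    simp only [h3, Finsupp.mapDomain_single, Finset.sum_add_distrib, Finset.sum_sub_distrib, h5,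
      Finset.sum_const, Finset.card_univ]
    abel
  refine ⟨s z.1, ?_⟩
  have hz : d z.1 = 0 := z.2
  have := DFunLike.congr_fun key z.1
  rw [AddMonoidHom.sub_apply, AddMonoidHom.comp_apply, AddMonoidHom.comp_apply, hz, map_zero,
    sub_zero] at this
  exact this

/-- `H₂` of a finite group is finitely generated and torsion. -/
theorem finite_H2 [Finite G] : Finite (H2Z G) := by
  have : Module.Finite ℤ (G × G →₀ ℤ) := inferInstance
  have : IsNoetherian ℤ (G × G →₀ ℤ) := isNoetherian_of_isNoetherianRing_of_finite ℤ _
  have : Module.Finite ℤ (cycles₂ (Rep.trivial ℤ G ℤ)) :=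
    Module.IsNoetherian.finite ℤ (cycles₂ (Rep.trivial ℤ G ℤ) : Submodule ℤ (G × G →₀ ℤ))
  have : Module.Finite ℤ (H2Z G) := Module.Finite.of_surjective (H2mk G) H2mk_surjective
  have hcard : (Nat.card G : ℤ) ∈ nonZeroDivisors ℤ :=
    mem_nonZeroDivisors_of_ne_zero (Int.natCast_ne_zero.2 Nat.card_pos.ne')
  exact Module.finite_of_fg_torsion _ fun {x} => ⟨⟨(Nat.card G : ℤ), hcard⟩,
    (Nat.cast_smul_eq_nsmul ℤ (Nat.card G) x).trans (card_nsmul_H2_eq_zero x)⟩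

/-! ### Cocycles with values in ℚ/ℤ -/

/-- The group `ℚ/ℤ`. -/
abbrev RatCircle : Type := AddCircle (1 : ℚ)

theorem exists_extend_hom {A B : Type} [AddCommGroup A] [AddCommGroup B] (i : A →+ B)
    (hi : Function.Injective i) (g : A →+ RatCircle) : ∃ h : B →+ RatCircle, h.comp i = g :=
  (Module.Baer.of_divisible _).extension_property_addMonoidHom i hi g

/-- Inhomogeneous `2`-cocycles of `G` with values in the trivial module `ℚ/ℤ`, not assumed to be
normalized. -/
def IsCocycle (f : G × G → RatCircle) : Prop :=
  ∀ x y z, f (y, z) - f (x * y, z) + f (x, y * z) - f (x, y) = 0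

/-- Inhomogeneous `2`-coboundaries of `G` with values in the trivial module `ℚ/ℤ`. -/
def IsCoboundary (f : G × G → RatCircle) : Prop :=
  ∃ h : G → RatCircle, ∀ x y, f (x, y) = h y - h (x * y) + h x

/-- The additive extension to chains of a `ℚ/ℤ`-valued function on a basis. -/
noncomputable def evalChain {X : Type} (f : X → RatCircle) : (X →₀ ℤ) →+ RatCircle :=
  Finsupp.liftAddHom fun p => (zmultiplesHom RatCircle) (f p)

@[simp]
theorem evalChain_single {X : Type} (f : X → RatCircle) (p : X) (n : ℤ) :
    evalChain f (Finsupp.single p n) = n • f p := by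
  simp [evalChain]

theorem evalChain_apply_single_one {X : Type} (h : (X →₀ ℤ) →+ RatCircle) :
    evalChain (fun p => h (Finsupp.single p 1)) = h := by
  refine Finsupp.addHom_ext fun p n => ?_
  rw [evalChain_single, ← map_zsmul]
  simp

theorem IsCoboundary.evalChain_eq_zero {f : G × G → RatCircle} (hf : IsCoboundary f)
    {z : G × G →₀ ℤ} (hz : z ∈ cycles₂ (Rep.trivial ℤ G ℤ)) : evalChain f z = 0 := by
  obtain ⟨h, hh⟩ := hf
  have key : evalChain f =
      (evalChain h).comp (d₂₁ (Rep.trivial ℤ G ℤ)).hom.toAddMonoidHom := by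
    refine Finsupp.addHom_ext fun ⟨x, y⟩ n => ?_
    have : (d₂₁ (Rep.trivial ℤ G ℤ)).hom.toAddMonoidHom (Finsupp.single (x, y) n) = _ :=
      d₂₁_trivial_single x y n
    rw [AddMonoidHom.comp_apply, this, evalChain_single, hh]
    simp [smul_add, smul_sub]
  have hz' : (d₂₁ (Rep.trivial ℤ G ℤ)).hom.toAddMonoidHom z = 0 := hz
  rw [key, AddMonoidHom.comp_apply, hz', map_zero]

/-- A cochain that vanishes on cycles factors through the boundaries, and extends from there to all
`1`-chains because `ℚ/ℤ` is divisible. -/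
theorem isCoboundary_of_evalChain_eq_zero {f : G × G → RatCircle}
    (hf : ∀ z ∈ cycles₂ (Rep.trivial ℤ G ℤ), evalChain f z = 0) : IsCoboundary f := by
  let d : (G × G →₀ ℤ) →+ (G →₀ ℤ) := (d₂₁ (Rep.trivial ℤ G ℤ)).hom.toAddMonoidHom
  have hker : d.ker ≤ (evalChain f).ker := hf
  obtain ⟨h, hh⟩ := exists_extend_hom (QuotientAddGroup.kerLift d)
    (QuotientAddGroup.kerLift_injective d)
    (QuotientAddGroup.lift d.ker (evalChain f) hker)
  refine ⟨fun x => h (Finsupp.single x 1), fun x y => ?_⟩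
  have e := DFunLike.congr_fun hh (QuotientAddGroup.mk (Finsupp.single (x, y) 1))
  rw [AddMonoidHom.comp_apply, QuotientAddGroup.kerLift_mk, QuotientAddGroup.lift_mk,
    evalChain_single, one_smul] at e
  have : d (Finsupp.single (x, y) 1) = _ := d₂₁_trivial_single x y 1
  rw [← e, this, map_add, map_sub]

/-- Every character of `H₂(G)` is given by a cocycle: as `ℚ/ℤ` is divisible, the induced character of
the `2`-cycles extends to all `2`-chains. -/
theorem exists_cocycle (χ : H2Z G →+ RatCircle) : ∃ f : G × G → RatCircle, IsCocycle f ∧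
    ∀ z : cycles₂ (Rep.trivial ℤ G ℤ), χ (H2mk G z) = evalChain f z.1 := by
  obtain ⟨h, hh⟩ := exists_extend_hom
    (cycles₂ (Rep.trivial ℤ G ℤ)).subtype.toAddMonoidHom
    (Submodule.injective_subtype (cycles₂ (Rep.trivial ℤ G ℤ)))
    (χ.comp (H2mk G).toAddMonoidHom)
  have hz : ∀ z : cycles₂ (Rep.trivial ℤ G ℤ), χ (H2mk G z) = h z.1 := fun z =>
    (DFunLike.congr_fun hh z).symm
  refine ⟨fun p => h (Finsupp.single p (1 : ℤ)), fun x y w => ?_, fun z => ?_⟩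
  · have hm := mem_boundaries₂_single x y w
    have hc : (Finsupp.single (y, w) 1 - Finsupp.single (x * y, w) 1 + Finsupp.single (x, y * w) 1 -
        Finsupp.single (x, y) 1 : G × G →₀ ℤ) ∈ cycles₂ (Rep.trivial ℤ G ℤ) := by
      obtain ⟨v, hv⟩ := hm
      exact hv ▸ d₃₂_apply_mem_cycles₂ v
    have := hz ⟨_, hc⟩
    rw [(H2mk_eq_zero_iff _).2 hm, map_zero] at this
    have e : h (_ - _ + _ - _) = _ := this.symm
    rwa [map_sub, map_add, map_sub] at e
  · exact (hz z).trans (DFunLike.congr_fun (evalChain_apply_single_one h) z.1).symm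

theorem evalChain_chainMap (φ : K →* G) (f : G × G → RatCircle) (z : K × K →₀ ℤ) :
    evalChain f (chainMap φ z) = evalChain (f ∘ Prod.map φ φ) z := by
  refine DFunLike.congr_fun (f := (evalChain f).comp (chainMap φ)) ?_ z
  refine Finsupp.addHom_ext fun p n => ?_
  simp [chainMap]

/-- A subgroup of `H₂(G)` is everything if each cocycle that kills it is a coboundary, since
`ℚ/ℤ`-valued characters separate points of the quotient. -/
theorem eq_top_of_cocycles_trivial (S : AddSubgroup (H2Z G))
    (h : ∀ f : G × G → RatCircle, IsCocycle f →
      (∀ z : cycles₂ (Rep.trivial ℤ G ℤ), H2mk G z ∈ S → evalChain f z.1 = 0) →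
        IsCoboundary f) : S = ⊤ := by
  by_contra hS
  obtain ⟨x, hx⟩ : ∃ x, x ∉ S := by
    by_contra! h
    exact hS ((AddSubgroup.eq_top_iff' S).2 h)
  have hx' : (QuotientAddGroup.mk x : H2Z G ⧸ S) ≠ 0 := by
    rwa [Ne, QuotientAddGroup.eq_zero_iff]
  obtain ⟨c, hc⟩ := CharacterModule.exists_character_apply_ne_zero_of_ne_zero hx'
  let χ : (H2Z G ⧸ S) →+ RatCircle := c
  obtain ⟨f, hf, hfz⟩ := exists_cocycle (χ.comp (QuotientAddGroup.mk' S))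
  obtain ⟨z, rfl⟩ := H2mk_surjective x
  refine hc ((hfz z).trans ((h f hf fun z hz => ?_).evalChain_eq_zero z.2))
  rw [← hfz z]
  have : QuotientAddGroup.mk' S (H2mk G z) = 0 := (QuotientAddGroup.eq_zero_iff _).2 hz
  rw [AddMonoidHom.comp_apply, this, map_zero]

/-! ### Central extensions -/

theorem IsCocycle.one_left {f : G × G → RatCircle} (hf : IsCocycle f) (x : G) : f (1, x) = f (1, 1) := by
  have := hf 1 1 x
  simp only [one_mul, sub_self, zero_add] at this
  exact sub_eq_zero.1 this

theorem IsCocycle.one_right {f : G × G → RatCircle} (hf : IsCocycle f) (x : G) : f (x, 1) = f (1, 1) := by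
  have := hf x 1 1
  simp only [mul_one, sub_add_cancel] at this
  exact (sub_eq_zero.1 this).symm

/-- The central extension of `G` by `ℚ/ℤ` defined by a `2`-cocycle `f`: pairs multiply by
`(m, x) (n, y) = (m + n + f(x, y), xy)`. As `f` need not be normalized, the unit is `(-f(1, 1), 1)`. -/
@[ext]
structure CocycleExt {f : G × G → RatCircle} (hf : IsCocycle f) where
  fiber : RatCircle
  base : G

namespace CocycleExt

variable {f : G × G → RatCircle} (hf : IsCocycle f)

instance : Group (CocycleExt hf) :=
  letI : Mul (CocycleExt hf) := ⟨fun a b => ⟨a.fiber + b.fiber + f (a.base, b.base), a.base * b.base⟩⟩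
  letI : One (CocycleExt hf) := ⟨⟨-f (1, 1), 1⟩⟩
  letI : Inv (CocycleExt hf) :=
    ⟨fun a => ⟨-a.fiber - f (a.base⁻¹, a.base) - f (1, 1), a.base⁻¹⟩⟩
  Group.ofLeftAxioms
    (fun a b c => CocycleExt.ext (by
      change a.fiber + b.fiber + f (a.base, b.base) + c.fiber + f (a.base * b.base, c.base) =
        a.fiber + (b.fiber + c.fiber + f (b.base, c.base)) + f (a.base, b.base * c.base)
      rw [← sub_eq_zero, ← neg_eq_zero, ← hf a.base b.base c.base]
      abel) (mul_assoc _ _ _))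
    (fun a => CocycleExt.ext (by
      change -f (1, 1) + a.fiber + f (1, a.base) = a.fiber
      rw [hf.one_left a.base, add_right_comm, neg_add_cancel, zero_add]) (one_mul _))
    (fun a => CocycleExt.ext (by
      change -a.fiber - f (a.base⁻¹, a.base) - f (1, 1) + a.fiber + f (a.base⁻¹, a.base) = -f (1, 1)
      abel) (inv_mul_cancel _))

/-- The projection of the central extension onto `G`. -/
def proj : CocycleExt hf →* G :=
  { toFun := base
    map_one' := rfl
    map_mul' := fun _ _ => rfl }

theorem ker_proj_le_center :
    (proj hf).ker ≤ Subgroup.center (CocycleExt hf) := by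
  intro a ha
  have ha : a.base = 1 := ha
  rw [Subgroup.mem_center_iff]
  intro b
  refine CocycleExt.ext ?_ ?_
  · change b.fiber + a.fiber + f (b.base, a.base) = a.fiber + b.fiber + f (a.base, b.base)
    rw [ha, hf.one_left, hf.one_right, add_comm b.fiber]
  · change b.base * a.base = a.base * b.base
    simp [ha]

/-- The pullback of a cocycle along `φ` is a coboundary exactly when `φ` lifts to the central
extension. -/
theorem isCoboundary_comp_iff (φ : K →* G) :
    IsCoboundary (f ∘ Prod.map φ φ) ↔ ∃ σ : K →* CocycleExt hf, (proj hf).comp σ = φ := by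
  constructor
  · rintro ⟨h, hh⟩
    refine ⟨MonoidHom.mk' (fun x => ⟨-h x, φ x⟩) fun x y => CocycleExt.ext ?_ (map_mul φ x y), ?_⟩
    · change -h (x * y) = -h x + -h y + f (φ x, φ y)
      have := hh x y
      simp only [Function.comp_apply, Prod.map_apply] at this
      rw [this]
      abel
    · rfl
  · rintro ⟨σ, hσ⟩
    have hb : ∀ x, (σ x).base = φ x := fun x => DFunLike.congr_fun hσ x
    refine ⟨fun x => -(σ x).fiber, fun x y => ?_⟩
    have : (σ (x * y)).fiber = (σ x).fiber + (σ y).fiber + f ((σ x).base, (σ y).base) :=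
      congrArg fiber (map_mul σ x y)
    rw [hb, hb] at this
    simp only [Function.comp_apply, Prod.map_apply]
    rw [this]
    abel

/-- A central extension of a finite cyclic group by `ℚ/ℤ` splits: a lift of a generator can be
corrected by a central element so as to have the right order, because `ℚ/ℤ` is divisible. -/
theorem exists_section_of_isCyclic [Finite G] [IsCyclic G] :
    ∃ σ : G →* CocycleExt hf, (proj hf).comp σ = MonoidHom.id G := by
  obtain ⟨a, ha⟩ := IsCyclic.exists_generator (α := G)
  -- The central embedding of `ℚ/ℤ`, shifted because the unit is `(-f(1, 1), 1)`.
  let incl : Multiplicative RatCircle →* CocycleExt hf :=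
    MonoidHom.mk' (fun m => ⟨m.toAdd - f (1, 1), 1⟩) fun m n => CocycleExt.ext
      (by change m.toAdd + n.toAdd - f (1, 1) =
            m.toAdd - f (1, 1) + (n.toAdd - f (1, 1)) + f (1, 1)
          abel) (one_mul _).symm
  let e : CocycleExt hf := ⟨0, a⟩
  have hn : orderOf a ≠ 0 := (orderOf_pos a).ne'
  have he : (e ^ orderOf a).base = 1 := by
    have : (proj hf) (e ^ orderOf a) = (proj hf e) ^ orderOf a := map_pow _ _ _
    exact this.trans (pow_orderOf_eq_one a)
  obtain ⟨t, ht⟩ : ∃ t : RatCircle, orderOf a • t = -((e ^ orderOf a).fiber + f (1, 1)) := by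
    refine ⟨DivisibleBy.div (-((e ^ orderOf a).fiber + f (1, 1))) (orderOf a : ℤ), ?_⟩
    rw [← natCast_zsmul]
    exact DivisibleBy.div_cancel _ (by exact_mod_cast hn)
  have hc : Commute (incl (Multiplicative.ofAdd t)) e :=
    ((Subgroup.mem_center_iff.1 (ker_proj_le_center hf
      (show incl (Multiplicative.ofAdd t) ∈ (proj hf).ker from rfl))) e).symm
  have hpow : (incl (Multiplicative.ofAdd t) * e) ^ orderOf a = 1 := by
    rw [hc.mul_pow, ← map_pow, ← ofAdd_nsmul, ht]
    refine CocycleExt.ext ?_ ?_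
    · change -((e ^ orderOf a).fiber + f (1, 1)) - f (1, 1) + (e ^ orderOf a).fiber +
        f (1, (e ^ orderOf a).base) = - f (1, 1)
      rw [he]
      abel
    · exact (one_mul _).trans he
  refine ⟨monoidHomOfForallMemZpowers ha (orderOf_dvd_of_pow_eq_one hpow), ?_⟩
  refine MonoidHom.eq_of_eqOn_dense (s := {a}) ?_ ?_
  · rw [← Subgroup.zpowers_eq_closure]
    exact (Subgroup.eq_top_iff' _).2 ha
  · rintro _ rfl
    rw [MonoidHom.comp_apply, monoidHomOfForallMemZpowers_apply_gen]
    exact one_mul _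

end CocycleExt

theorem H2_eq_zero_of_isCyclic [Finite G] [IsCyclic G] (x : H2Z G) : x = 0 := by
  have : (⊥ : AddSubgroup (H2Z G)) = ⊤ := eq_top_of_cocycles_trivial _ fun f hf _ =>
    (CocycleExt.isCoboundary_comp_iff hf (MonoidHom.id G)).2
      (CocycleExt.exists_section_of_isCyclic hf)
  exact (AddSubgroup.mem_bot).1 (this ▸ AddSubgroup.mem_top x)

/-! ### Lifting perfect groups -/

section Lifting

variable {E Γ P A : Type} [Group E] [Group Γ] [Group P] [Group A] {p : E →* Γ}

/-- Two lifts of a homomorphism to a central extension differ by central factors, so they agree on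
commutators. -/
theorem lift_unique_of_isPerfect [Group.IsPerfect P] (hp : p.ker ≤ Subgroup.center E)
    {α β : P →* E} (h : p.comp α = p.comp β) : α = β := by
  have hmem : ∀ x, α x * (β x)⁻¹ ∈ Subgroup.center E := fun x => hp (by
    have := DFunLike.congr_fun h x
    simp only [MonoidHom.comp_apply] at this
    simp [MonoidHom.mem_ker, this])
  have hle : commutator P ≤ α.eqLocus β := by
    rw [commutator_def, Subgroup.commutator_le]
    intro x _ y _
    have hx := Subgroup.mem_center_iff.1 (hmem x)
    have hy := Subgroup.mem_center_iff.1 (hmem y)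
    have ex : α x = α x * (β x)⁻¹ * β x := by group
    have ey : α y = α y * (β y)⁻¹ * β y := by group
    generalize α x * (β x)⁻¹ = z at hx ex
    generalize α y * (β y)⁻¹ = w at hy ey
    refine (map_commutatorElement α x y).trans (Eq.trans ?_ (map_commutatorElement β x y).symm)
    rw [ex, ey, commutatorElement_def,
      commutatorElement_def, mul_inv_rev, mul_inv_rev, ← hx, ← hy]
    calc β x * z * (β y * w) * ((β x)⁻¹ * z⁻¹) * ((β y)⁻¹ * w⁻¹)
        = β x * (z * (β y * w * (β x)⁻¹)) * z⁻¹ * (β y)⁻¹ * w⁻¹ := by group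
      _ = β x * β y * (w * ((β x)⁻¹ * (β y)⁻¹)) * w⁻¹ := by rw [← hx]; group
      _ = β x * β y * (β x)⁻¹ * (β y)⁻¹ := by rw [← hy]; group
  ext x
  exact hle Group.IsPerfect.mem_commutator

/-- A lift `α` to a central extension and its conjugate by `e` lift the same homomorphism if `e`
commutes with `α` downstairs, so they coincide when the source is perfect. -/
theorem commute_lift_of_isPerfect [Group.IsPerfect P] (hp : p.ker ≤ Subgroup.center E)
    (α : P →* E) (e : E) (h : ∀ x, Commute (p (α x)) (p e)) (x : P) : Commute (α x) e := by
  have : α = (MulAut.conj e).toMonoidHom.comp α := lift_unique_of_isPerfect hp (by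
    ext x
    simp [← (h x).eq])
  have := DFunLike.congr_fun this x
  simp only [MonoidHom.comp_apply, MulEquiv.coe_toMonoidHom, MulAut.conj_apply] at this
  exact eq_mul_inv_iff_mul_eq.1 this

/-- A central extension of a semidirect product `P ⋊ A` with `P` perfect splits as soon as it splits
over `P` and over `A`: by uniqueness of lifts from `P`, the two splittings are automatically
compatible with the action of `A`. -/
theorem exists_section_of_lifts [Group.IsPerfect P] (hp : p.ker ≤ Subgroup.center E)
    (i : P →* Γ) (π : Γ →* A) (s : A →* Γ) (hs : ∀ a, π (s a) = a) (hi : Function.Injective i)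
    (hker : π.ker = i.range) (α : P →* E) (hα : p.comp α = i) (β : A →* E) (hβ : p.comp β = s) :
    ∃ σ : Γ →* E, p.comp σ = MonoidHom.id Γ := by
  have hα' : ∀ x, p (α x) = i x := DFunLike.congr_fun hα
  have hβ' : ∀ x, p (β x) = s x := DFunLike.congr_fun hβ
  have hk : ∀ g : Γ, ∃ x, i x = g * (s (π g))⁻¹ := fun g => by
    have : g * (s (π g))⁻¹ ∈ π.ker := by simp [MonoidHom.mem_ker, hs]
    rwa [hker] at this
  -- Every `g` is `i (ν g) * s (π g)`.
  choose ν hν using hk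
  have hact : ∀ a x, ∃ y, i y = s a * i x * (s a)⁻¹ := fun a x => by
    have h : i x ∈ π.ker := hker ▸ ⟨x, rfl⟩
    have : s a * i x * (s a)⁻¹ ∈ π.ker := by
      simp [MonoidHom.mem_ker, hs, MonoidHom.mem_ker.1 h]
    rwa [hker] at this
  -- The lift `α` is equivariant for `A`.
  have hconj : ∀ a x y, i y = s a * i x * (s a)⁻¹ → α y = β a * α x * (β a)⁻¹ := by
    intro a x y hy
    choose c hc using hact a
    let γ : P →* P := MonoidHom.mk' c fun x y => hi (by rw [hc, map_mul, map_mul, hc, hc]; group)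
    have e : α.comp γ = (MulAut.conj (β a)).toMonoidHom.comp α := lift_unique_of_isPerfect hp (by
      ext x
      simp [hα', hβ', γ, hc])
    have : y = γ x := hi (hy.trans (hc x).symm)
    rw [this]
    exact DFunLike.congr_fun e x
  refine ⟨MonoidHom.mk' (fun g => α (ν g) * β (π g)) fun g h => ?_, ?_⟩
  · obtain ⟨y, hy⟩ := hact (π g) (ν h)
    have : ν (g * h) = ν g * y := hi (by
      rw [hν, map_mul i, hν, hy, hν, map_mul, map_mul]; group)
    rw [this, map_mul, hconj _ _ _ hy, map_mul, map_mul]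
    group
  · ext g
    simp [hα', hβ', hν]

end Lifting

/-! ### Perfectness of the derived group -/

theorem isPerfect_of_isSimpleGroup {T : Type} [Group T] [IsSimpleGroup T]
    (hT : ∃ a b : T, a * b ≠ b * a) : Group.IsPerfect T := by
  obtain ⟨a, b, hab⟩ := hT
  refine ⟨(Subgroup.Normal.eq_bot_or_eq_top (H := commutator T) inferInstance).resolve_left
    fun h => hab ?_⟩
  exact commutatorElement_eq_one_iff_mul_comm.1 ((Subgroup.eq_bot_iff_forall _).1 h _
    (Subgroup.commutator_mem_commutator (Subgroup.mem_top a) (Subgroup.mem_top b)))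

instance isPerfect_pi {ι : Type} [Finite ι] (H : ι → Type) [∀ i, Group (H i)]
    [∀ i, Group.IsPerfect (H i)] : Group.IsPerfect (∀ i, H i) := by
  refine ⟨?_⟩
  rw [commutator_def, ← Subgroup.pi_top (I := Set.univ), Subgroup.commutator_pi_pi_of_finite]
  congr 1
  ext1 i
  exact Group.IsPerfect.commutator_eq_top

theorem IsPseudosimple.isPerfect_commutator (hG : IsPseudosimple G) :
    Group.IsPerfect (commutator G) := by
  obtain ⟨T, _, w, _, hT, _, ⟨e⟩⟩ := hG.derived_eq_power
  have := isPerfect_of_isSimpleGroup hT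
  exact Group.IsPerfect.ofSurjective (f := e.symm.toMonoidHom) e.symm.surjective

/-! ### Fiber powers -/

section FiberPower

variable (G) in
/-- The projection of the fiber power `G^[k]` onto a coordinate. -/
def fiberProj {k : ℕ} (i : Fin k) : fiberPower G k →* G :=
  (Pi.evalMonoidHom _ i).comp (fiberPower G k).subtype

@[simp]
theorem fiberProj_apply {k : ℕ} (i : Fin k) (x : fiberPower G k) :
    fiberProj G i x = (x : Fin k → G) i := rfl

theorem of_eq_one_iff {x : G} : Abelianization.of x = 1 ↔ x ∈ commutator G := by
  rw [← MonoidHom.mem_ker, Abelianization.ker_of]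

variable (G) in
/-- The inclusion of `(G')^k` into `G^[k]`. -/
def fiberIncl (k : ℕ) : (Fin k → commutator G) →* fiberPower G k :=
  MonoidHom.mk' (fun x => ⟨fun i => (x i : G), fun a b => by
    rw [of_eq_one_iff.2 (x a).2, of_eq_one_iff.2 (x b).2]⟩) fun _ _ => rfl

theorem fiberIncl_injective (k : ℕ) : Function.Injective (fiberIncl G k) := fun x y h => by
  ext i
  exact congrFun (congrArg Subtype.val h) i

theorem ker_of_comp_fiberProj {k : ℕ} (i : Fin k) :
    (Abelianization.of.comp (fiberProj G i)).ker = (fiberIncl G k).range := by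
  ext x
  rw [MonoidHom.mem_ker, MonoidHom.mem_range]
  constructor
  · intro hx
    exact ⟨fun j => ⟨(x : Fin k → G) j, of_eq_one_iff.1 ((x.2 j i).trans hx)⟩, rfl⟩
  · rintro ⟨y, rfl⟩
    exact of_eq_one_iff.2 (y i).2

variable {s : Abelianization G →* G} (hs : ∀ a, Abelianization.of (s a) = a)

/-- For a section `s` of `G → G^ab`, the homomorphism `G → G^[k]` that puts `g` in slot `j` and
`s(ḡ)` in all others. -/
def fiberSlot {k : ℕ} (j : Fin k) : G →* fiberPower G k :=
  MonoidHom.mk' (fun g => ⟨Function.update (fun _ => s (Abelianization.of g)) j g, fun a b => by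
    have : ∀ c, Abelianization.of (Function.update (fun _ => s (Abelianization.of g)) j g c) =
        Abelianization.of g := fun c => by
      by_cases h : c = j
      · subst h; simp
      · simp [h, hs]
    rw [this, this]⟩) fun x y => by
      ext c
      by_cases h : c = j
      · subst h; simp
      · simp [h]

theorem fiberProj_comp_fiberSlot_self {k : ℕ} (j : Fin k) :
    (fiberProj G j).comp (fiberSlot hs j) = MonoidHom.id G := by
  ext g
  simp [fiberSlot]

theorem fiberProj_comp_fiberSlot_of_ne {k : ℕ} {i j : Fin k} (h : i ≠ j) :
    (fiberProj G i).comp (fiberSlot hs j) = s.comp Abelianization.of := by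
  ext g
  simp [fiberSlot, h]

theorem fiberSlot_of_mem_commutator {k : ℕ} (j : Fin k) (x : commutator G) :
    fiberSlot hs j (x : G) = fiberIncl G k (Pi.mulSingle j x) := by
  ext c
  by_cases h : c = j
  · subst h; simp [fiberSlot, fiberIncl]
  · simp [fiberSlot, fiberIncl, h, of_eq_one_iff.2 x.2]

/-- The diagonal copy in `G^[k]` of a complement to `G'`. -/
def fiberDiag (s : Abelianization G →* G) (k : ℕ) : Abelianization G →* fiberPower G k :=
  MonoidHom.mk' (fun a => ⟨fun _ => s a, fun _ _ => rfl⟩) fun a b => by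
    ext c
    exact map_mul s a b

theorem fiberSlot_comp_section {k : ℕ} (j : Fin k) :
    (fiberSlot hs j).comp s = fiberDiag s k := by
  ext a c
  by_cases h : c = j
  · subst h; simp [fiberSlot, fiberDiag]
  · simp [fiberSlot, fiberDiag, hs]

theorem commute_fiberSlot {k : ℕ} {i j : Fin k} (h : i ≠ j) (x y : commutator G) :
    Commute (fiberSlot hs i (x : G)) (fiberSlot hs j (y : G)) := by
  rw [fiberSlot_of_mem_commutator, fiberSlot_of_mem_commutator]
  exact (Pi.mulSingle_commute (f := fun _ : Fin k => commutator G) h x y).map _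

/-- The images of the slot homomorphisms generate `H₂(G^[k])`. This is where the perfectness of `G'`
enters. -/
theorem iSup_range_H2map_fiberSlot [Group.IsPerfect (commutator G)] {k : ℕ} (hk : 1 ≤ k) :
    ⨆ j : Fin k, (H2map (fiberSlot hs j)).range = ⊤ := by
  refine eq_top_of_cocycles_trivial _ fun f hf hS => ?_
  have hlift : ∀ j : Fin k, ∃ σ : G →* CocycleExt hf,
      (CocycleExt.proj hf).comp σ = fiberSlot hs j := fun j => by
    rw [← CocycleExt.isCoboundary_comp_iff]
    refine isCoboundary_of_evalChain_eq_zero fun z hz => ?_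
    rw [← evalChain_chainMap]
    refine hS ⟨_, chainMap_mem_cycles _ hz⟩ ?_
    rw [← H2map_H2mk _ ⟨z, hz⟩]
    exact AddSubgroup.mem_iSup_of_mem j ⟨_, rfl⟩
  choose σ hσ using hlift
  have hσ' : ∀ j g, CocycleExt.proj hf (σ j g) = fiberSlot hs j g := fun j =>
    DFunLike.congr_fun (hσ j)
  -- The lifts of different copies of `G'` commute.
  have hcomm : Pairwise fun i j : Fin k => ∀ x y : commutator G,
      Commute ((σ i).comp (commutator G).subtype x) ((σ j).comp (commutator G).subtype y) := by
    intro i j hij x y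
    refine commute_lift_of_isPerfect (CocycleExt.ker_proj_le_center hf) _ _ (fun x => ?_) x
    simp only [MonoidHom.comp_apply, hσ', Subgroup.subtype_apply]
    exact commute_fiberSlot hs hij x y
  let α := MonoidHom.noncommPiCoprod (fun j => (σ j).comp (commutator G).subtype) hcomm
  have hα : (CocycleExt.proj hf).comp α = fiberIncl G k := by
    have : (⊤ : Subgroup (Fin k → commutator G)) ≤
        ((CocycleExt.proj hf).comp α).eqLocus (fiberIncl G k) := by
      rw [← Subgroup.pi_top (I := Set.univ), Subgroup.pi_le_iff]
      rintro j _ ⟨x, -, rfl⟩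
      change CocycleExt.proj hf (α (Pi.mulSingle j x)) = fiberIncl G k (Pi.mulSingle j x)
      rw [MonoidHom.noncommPiCoprod_mulSingle, MonoidHom.comp_apply, hσ']
      exact fiberSlot_of_mem_commutator hs j x
    ext1 x
    exact this (Subgroup.mem_top x)
  let i₀ : Fin k := ⟨0, hk⟩
  refine (CocycleExt.isCoboundary_comp_iff hf (MonoidHom.id _)).2 ?_
  refine exists_section_of_lifts (CocycleExt.ker_proj_le_center hf) (fiberIncl G k)
    (Abelianization.of.comp (fiberProj G i₀)) (fiberDiag s k) hs (fiberIncl_injective k)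
    (ker_of_comp_fiberProj i₀) α hα ((σ i₀).comp s) ?_
  rw [← MonoidHom.comp_assoc, hσ, fiberSlot_comp_section]

variable (G) in
/-- The map `H₂(G^[k]) → H₂(G)^k` induced by the coordinate projections. -/
noncomputable def H2fiberProj (k : ℕ) : H2Z (fiberPower G k) →+ (Fin k → H2Z G) :=
  AddMonoidHom.pi fun i => H2map (fiberProj G i)

@[simp]
theorem H2fiberProj_apply {k : ℕ} (x : H2Z (fiberPower G k)) (i : Fin k) :
    H2fiberProj G k x i = H2map (fiberProj G i) x := rfl

end FiberPower

theorem H2fiberProj_bijective {s : Abelianization G →* G}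
    (hs : ∀ a, Abelianization.of (s a) = a) [Finite G] [Group.IsPerfect (commutator G)]
    [IsCyclic (Abelianization G)] {k : ℕ} (hk : 1 ≤ k) :
    Function.Bijective (H2fiberProj G k) := by
  have : Finite (Abelianization G) := Quotient.finite _
  -- The inverse map, given by the slot homomorphisms.
  let Ψ : (Fin k → H2Z G) →+ H2Z (fiberPower G k) :=
    ∑ j, (H2map (fiberSlot hs j)).comp (Pi.evalAddMonoidHom _ j)
  have hΨ : ∀ x, Ψ x = ∑ j, H2map (fiberSlot hs j) (x j) := fun x => by
    simp [Ψ, AddMonoidHom.finsetSum_apply]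
  have hleft : ∀ x, H2fiberProj G k (Ψ x) = x := by
    intro x
    ext1 i
    rw [H2fiberProj_apply, hΨ, map_sum, Finset.sum_eq_single i]
    · rw [← H2map_comp, fiberProj_comp_fiberSlot_self, H2map_id]
    · intro j _ hji
      rw [← H2map_comp, fiberProj_comp_fiberSlot_of_ne hs hji.symm, H2map_comp,
        H2_eq_zero_of_isCyclic (H2map Abelianization.of _), map_zero]
    · simp
  have hsurj : Function.Surjective Ψ := by
    rw [← AddMonoidHom.range_eq_top, eq_top_iff, ← iSup_range_H2map_fiberSlot hs hk]
    refine iSup_le fun j => ?_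
    rintro _ ⟨x, rfl⟩
    refine ⟨Pi.single j x, ?_⟩
    rw [hΨ, Finset.sum_eq_single j]
    · simp
    · intro i _ hij
      simp [hij]
    · simp
  refine ⟨fun x y hxy => ?_, fun x => ⟨Ψ x, hleft x⟩⟩
  obtain ⟨x, rfl⟩ := hsurj x
  obtain ⟨y, rfl⟩ := hsurj y
  rw [hleft, hleft] at hxy
  rw [hxy]

/-! ### Brackets in fiber powers -/

variable {r : ℕ}

theorem bracket_mem_H2List {C : Fin r → Set G} {i : Fin r} {g z : G} (h : Commute g z)
    (hg : g ∈ C i) : bracket h ∈ H2List C :=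
  AddSubgroup.mem_iSup_of_mem i (AddSubgroup.subset_closure ⟨g, z, h, hg, rfl⟩)

theorem bracket_mem_H2ListDerived {C : Fin r → Set G} {i : Fin r} {g z : G} (h : Commute g z)
    (hg : g ∈ C i) (hz : z ∈ commutator G) : bracket h ∈ H2ListDerived C :=
  AddSubgroup.mem_iSup_of_mem i (AddSubgroup.subset_closure ⟨g, z, h, hg, hz, rfl⟩)

theorem H2List_le_iff {C : Fin r → Set G} {S : AddSubgroup (H2Z G)} :
    H2List C ≤ S ↔ ∀ i, ∀ g ∈ C i, ∀ (z : G) (h : Commute g z), bracket h ∈ S := by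
  refine ⟨fun hS i g hg z h => hS (bracket_mem_H2List h hg), fun hS => iSup_le fun i => ?_⟩
  refine (AddSubgroup.closure_le _).2 ?_
  rintro _ ⟨g, z, h, hg, rfl⟩
  exact hS i g hg z h

theorem H2ListDerived_le_iff {C : Fin r → Set G} {S : AddSubgroup (H2Z G)} :
    H2ListDerived C ≤ S ↔
      ∀ i, ∀ g ∈ C i, ∀ z ∈ commutator G, ∀ h : Commute g z, bracket h ∈ S := by
  refine ⟨fun hS i g hg z hz h => hS (bracket_mem_H2ListDerived h hg hz),
    fun hS => iSup_le fun i => ?_⟩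
  refine (AddSubgroup.closure_le _).2 ?_
  rintro _ ⟨g, z, h, hg, hz, rfl⟩
  exact hS i g hg z hz h

theorem H2ListDerived_le (C : Fin r → Set G) : H2ListDerived C ≤ H2List C :=
  H2ListDerived_le_iff.2 fun _ _ hg _ _ h => bracket_mem_H2List h hg

theorem bracket_one_right (g : G) (h : Commute g 1) : bracket h = 0 := by
  have e : bracket (h.mul_right h) = bracket h := by congr 1; exact mul_one 1
  rw [bracket_mul_right h h] at e
  exact add_eq_left.1 e

theorem bracket_pow_right {g z : G} (h : Commute g z) (n : ℕ) :
    bracket (h.pow_right n) = n • bracket h := by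
  induction n with
  | zero =>
    rw [zero_nsmul, ← bracket_one_right g (Commute.one_right g)]
    congr 1; exact pow_zero z
  | succ n ih =>
    rw [succ_nsmul, ← ih, ← bracket_mul_right]
    congr 1; exact pow_succ z n

theorem map_H2List_classPowers_le (C : Fin r → ConjClasses G) (k : ℕ) :
    (H2List (classPowers C k)).map (H2fiberProj G k) ≤
      AddSubgroup.pi Set.univ fun _ => H2List (classSets C) := by
  rw [AddSubgroup.map_le_iff_le_comap, H2List_le_iff]
  intro i g hg z h a _
  rw [H2fiberProj_apply, H2map_bracket]
  exact bracket_mem_H2List (C := classSets C) (i := i) _ (hg a)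

theorem pi_H2ListDerived_le_map (C : Fin r → ConjClasses G) (k : ℕ) :
    (AddSubgroup.pi Set.univ fun _ => H2ListDerived (classSets C)) ≤
      (H2List (classPowers C k)).map (H2fiberProj G k) := by
  rw [AddSubgroup.pi_le_iff]
  intro j
  rw [AddSubgroup.map_le_iff_le_comap, H2ListDerived_le_iff]
  intro i g hg z hz h
  let g' : fiberPower G k := ⟨fun _ => g, fun _ _ => rfl⟩
  let z' : fiberPower G k := fiberIncl G k (Pi.mulSingle j ⟨z, hz⟩)
  have hz' : ∀ a, fiberProj G a z' = if a = j then z else 1 := fun a => by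
    by_cases ha : a = j
    · subst ha; simp [z', fiberIncl]
    · simp [z', fiberIncl, ha]
  have hc : Commute g' z' := by
    refine Subtype.ext (funext fun a => ?_)
    change g * fiberProj G a z' = fiberProj G a z' * g
    rw [hz']
    split_ifs
    · exact h
    · simp
  refine ⟨bracket hc, bracket_mem_H2List (C := classPowers C k) (i := i) hc fun _ => hg, ?_⟩
  ext1 a
  rw [H2fiberProj_apply, H2map_bracket]
  by_cases ha : a = j
  · subst ha
    rw [AddMonoidHom.single_apply, Pi.single_eq_same]
    congr 1
    exact (hz' a).trans (if_pos rfl)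
  · rw [AddMonoidHom.single_apply, Pi.single_eq_of_ne ha,
      ← bracket_one_right g (Commute.one_right g)]
    congr 1
    exact (hz' a).trans (if_neg ha)

/-- Any two coordinates of an element of `H₂(G^[k])_{C^k}` agree modulo `H₂'(G)_C`. -/
theorem H2map_fiberProj_sub_mem (C : Fin r → ConjClasses G) {k : ℕ} (a b : Fin k)
    {x : H2Z (fiberPower G k)} (hx : x ∈ H2List (classPowers C k)) :
    H2map (fiberProj G a) x - H2map (fiberProj G b) x ∈ H2ListDerived (classSets C) := by
  suffices H2List (classPowers C k) ≤ (H2ListDerived (classSets C)).comap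
      (H2map (fiberProj G a) - H2map (fiberProj G b)) from this hx
  rw [H2List_le_iff]
  intro i g hg z h
  change H2map (fiberProj G a) (bracket h) - H2map (fiberProj G b) (bracket h) ∈
    H2ListDerived (classSets C)
  rw [H2map_bracket, H2map_bracket]
  have ha := h.map (fiberProj G a)
  have hb := h.map (fiberProj G b)
  have hga : fiberProj G a g ∈ (C i).carrier := hg a
  have hgb : fiberProj G b g ∈ (C i).carrier := hg b
  have hz : Abelianization.of (fiberProj G a z) = Abelianization.of (fiberProj G b z) := z.2 a b
  change bracket ha - bracket hb ∈ H2ListDerived (classSets C)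
  generalize fiberProj G a g = x at ha hga
  generalize fiberProj G b g = y at hb hgb
  generalize fiberProj G a z = u at ha hz
  generalize fiberProj G b z = v at hb hz
  -- Conjugation moves the second bracket to the same first entry; it leaves the class of the second
  -- entry in the abelianization unchanged.
  obtain ⟨c, rfl⟩ : ∃ c : G, c * y * c⁻¹ = x := isConj_iff.1 (ConjClasses.mk_eq_mk_iff_isConj.1
    ((ConjClasses.mem_carrier_iff_mk_eq.1 hgb).trans (ConjClasses.mem_carrier_iff_mk_eq.1 hga).symm))
  have hb' : Commute (c * y * c⁻¹) (c * v * c⁻¹) := hb.map (MulAut.conj c)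
  rw [← bracket_conj hb c hb']
  have hd : Commute (c * y * c⁻¹) (u * (c * v * c⁻¹)⁻¹) := ha.mul_right hb'.inv_right
  have e : bracket ha = bracket (hd.mul_right hb') := by
    congr 1
    group
  rw [e, bracket_mul_right hd hb', add_sub_cancel_right]
  refine bracket_mem_H2ListDerived (C := classSets C) (i := i) hd hga ?_
  rw [← of_eq_one_iff]
  simp [hz]

/-- The cardinality condition for the `k`-th fiber power says that the image of `H₂(G^[k])_{C^k}` in
`H₂(G)^k`, which always lies in the `k`-th power of `H₂(G)_C`, is the whole of it. -/
theorem card_reducedH2_classPowers_eq_iff {C : Fin r → ConjClasses G} {k : ℕ} [Finite G]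
    (hb : Function.Bijective (H2fiberProj G k)) :
    Nat.card (ReducedH2 (classPowers C k)) = Nat.card (ReducedH2 (classSets C)) ^ k ↔
      (AddSubgroup.pi Set.univ fun _ => H2List (classSets C)) ≤
        (H2List (classPowers C k)).map (H2fiberProj G k) := by
  have := finite_H2 (G := G)
  have h1 : Nat.card (ReducedH2 (classPowers C k)) =
      ((H2List (classPowers C k)).map (H2fiberProj G k)).index :=
    (AddSubgroup.index_map_of_bijective hb _).symm
  have h2 : Nat.card (ReducedH2 (classSets C)) ^ k =
      (AddSubgroup.pi Set.univ fun _ : Fin k => H2List (classSets C)).index := by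
    rw [AddSubgroup.index_pi, Finset.prod_const, Finset.card_univ, Fintype.card_fin]
    rfl
  rw [h1, h2, ← AddSubgroup.relIndex_mul_index (map_H2List_classPowers_le C k),
    ← AddSubgroup.relIndex_eq_one]
  exact mul_eq_right₀ AddSubgroup.index_ne_zero_of_finite

theorem H2List_eq_derived_of_coprime [Finite G] (C : Fin r → Set G)
    (h : Nat.Coprime (Nat.card (Abelianization G)) (Nat.card (H2Z G))) :
    H2List C = H2ListDerived C := by
  have := finite_H2 (G := G)
  refine le_antisymm (H2List_le_iff.2 fun i g hg z hgz => ?_) (H2ListDerived_le C)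
  have hz : z ^ Nat.card (Abelianization G) ∈ commutator G := by
    rw [← of_eq_one_iff, map_pow, pow_card_eq_one']
  have hmem := bracket_mem_H2ListDerived (C := C) (hgz.pow_right _) hg hz
  rw [bracket_pow_right hgz] at hmem
  obtain ⟨m, hm⟩ := exists_nsmul_eq_self_of_coprime
    (h.coprime_dvd_right (addOrderOf_dvd_natCard (bracket hgz)))
  exact hm ▸ nsmul_mem hmem m

end SchurMult

open SchurMult in
theorem proposition5p2 (G : Type) [Group G] (hG : SchurMult.IsPseudosimple G)
    (hsc : SchurMult.IsSplitCyclic G) (r : ℕ) (C : Fin r → ConjClasses G)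
    (hdistinct : Function.Injective C) (hunamb : ∀ i, SchurMult.IsUnambiguous (C i)) :
    List.TFAE
      [Nat.card (SchurMult.ReducedH2 (SchurMult.classPowers C 2)) =
          Nat.card (SchurMult.ReducedH2 (SchurMult.classSets C)) ^ 2,
        ∀ k : ℕ, 1 ≤ k →
          Nat.card (SchurMult.ReducedH2 (SchurMult.classPowers C k)) =
            Nat.card (SchurMult.ReducedH2 (SchurMult.classSets C)) ^ k,
        SchurMult.H2List (SchurMult.classSets C) =
          SchurMult.H2ListDerived (SchurMult.classSets C)] ∧
    (Nat.Coprime (Nat.card (Abelianization G)) (Nat.card (SchurMult.H2Z G)) →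
      Nat.card (SchurMult.ReducedH2 (SchurMult.classPowers C 2)) =
          Nat.card (SchurMult.ReducedH2 (SchurMult.classSets C)) ^ 2 ∧
      (∀ k : ℕ, 1 ≤ k →
          Nat.card (SchurMult.ReducedH2 (SchurMult.classPowers C k)) =
            Nat.card (SchurMult.ReducedH2 (SchurMult.classSets C)) ^ k) ∧
      SchurMult.H2List (SchurMult.classSets C) =
        SchurMult.H2ListDerived (SchurMult.classSets C)) := by
  have := hG.finite
  have := hG.isPerfect_commutator
  obtain ⟨⟨s, hs⟩, hcyc⟩ := hsc
  have h31 : H2List (classSets C) = H2ListDerived (classSets C) → ∀ k : ℕ, 1 ≤ k →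
      Nat.card (ReducedH2 (classPowers C k)) = Nat.card (ReducedH2 (classSets C)) ^ k := by
    intro hE k hk
    rw [card_reducedH2_classPowers_eq_iff (H2fiberProj_bijective hs hk), hE]
    exact pi_H2ListDerived_le_map C k
  have htfae : List.TFAE
      [Nat.card (ReducedH2 (classPowers C 2)) = Nat.card (ReducedH2 (classSets C)) ^ 2,
        ∀ k : ℕ, 1 ≤ k →
          Nat.card (ReducedH2 (classPowers C k)) = Nat.card (ReducedH2 (classSets C)) ^ k,
        H2List (classSets C) = H2ListDerived (classSets C)] := by
    tfae_have 3 → 2 := h31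
    tfae_have 2 → 1 := fun h => h 2 one_le_two
    tfae_have 1 → 3 := by
      intro h
      rw [card_reducedH2_classPowers_eq_iff (H2fiberProj_bijective hs one_le_two)] at h
      refine le_antisymm (fun ξ hξ => ?_) (H2ListDerived_le _)
      -- Lift `(ξ, 0)` to `H₂(G^[2])_{C^2}`.
      obtain ⟨x, hx, hxξ⟩ := h (show (Pi.single 0 ξ : Fin 2 → H2Z G) ∈ _ from fun a _ => by
        by_cases ha : a = 0
        · subst ha; simpa using hξ
        · simp [ha])
      have h0 : H2map (fiberProj G 0) x = ξ := by simpa using congrFun hxξ 0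
      have h1 : H2map (fiberProj G 1) x = 0 := by simpa using congrFun hxξ 1
      simpa [h0, h1] using H2map_fiberProj_sub_mem C 0 1 hx
    tfae_finish
  refine ⟨htfae, fun hco => ?_⟩
  have hE := H2List_eq_derived_of_coprime (classSets C) hco
  exact ⟨h31 hE 2 one_le_two, h31 hE, hE⟩
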